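/- Let $p\ge 5$ be a prime, and let $s_a,t_a\in\mathbb C$, indexed by $a\in(\mathbb Z/p\mathbb Z)\setminus\{0\}$, be a solution of the quadratic relations, that is, $s_{-a}=-s_a$ for all $a\ne 0$ and $$s_as_b+s_bs_c+s_cs_a+t_a+t_b+t_c=0\qquad\text{for all } a,b,c\neq 0 \text{ with } a+b+c=0$$ (it follows that $t_{-a}=t_a$). Let $I_{s,t}$ be the homogeneous ideal of $\mathbb C[r_0,r_1,\ldots,r_{p-1}]$ (subscripts read modulo $p$) generated by all the quadrics $$r_ar_b-r_cr_d-r_0r_{a+b}(s_a+s_b-s_c-s_d),\qquad a,b,c,d\ne 0,\quad a+b=c+d\neq 0,$$ and $$r_ar_{-a}-r_br_{-b}-r_0^2(-s_a^2+2t_a+s_b^2-2t_b),\qquad a,b\ne 0.$$ Then for every $n>0$ $$\dim_{\mathbb C}\bigl(\mathbb C[r_0,r_1,\ldots,r_{p-1}]/I_{s,t}\bigr)_n=np,$$ and the component of degree $0$ has dimension $1$. (This is the Hilbert function of the homogeneous coordinate ring of an elliptic normal curve of degree $p$ in $\mathbb P^{p-1}$.) -/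

import Mathlib

open MvPolynomial

/-- `(s, t)` is a solution of the quadratic relations of level `p`. The coordinates `s a`, `t a`
are indexed by the nonzero residues `a` modulo `p`, so the values `s 0`, `t 0` are never used,
neither here nor below. The `s a` are odd; evenness of `t` is a consequence. -/
structure IsQuadraticSolution (p : ℕ) (s t : ZMod p → ℂ) : Prop where
  odd : ∀ a : ZMod p, a ≠ 0 → s (-a) = -s a
  rel : ∀ a b c : ZMod p, a ≠ 0 → b ≠ 0 → c ≠ 0 → a + b + c = 0 →
    s a * s b + s b * s c + s c * s a + t a + t b + t c = 0

/-- The quadric `r_a r_b - r_c r_d - r_0 r_{a+b} (s_a + s_b - s_c - s_d)`. -/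
noncomputable def quadricOne {p : ℕ} (s : ZMod p → ℂ) (a b c d : ZMod p) :
    MvPolynomial (ZMod p) ℂ :=
  X a * X b - X c * X d - C (s a + s b - s c - s d) * (X 0 * X (a + b))

/-- The quadric `r_a r_{-a} - r_b r_{-b} - r_0 ^ 2 (-s_a ^ 2 + 2 t_a + s_b ^ 2 - 2 t_b)`. -/
noncomputable def quadricTwo {p : ℕ} (s t : ZMod p → ℂ) (a b : ZMod p) :
    MvPolynomial (ZMod p) ℂ :=
  X a * X (-a) - X b * X (-b) - C (-s a ^ 2 + 2 * t a + s b ^ 2 - 2 * t b) * X 0 ^ 2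

/-- The set of all quadrics generating the ideal. -/
def quadricSet {p : ℕ} (s t : ZMod p → ℂ) : Set (MvPolynomial (ZMod p) ℂ) :=
  {f | ∃ a b c d : ZMod p, a ≠ 0 ∧ b ≠ 0 ∧ c ≠ 0 ∧ d ≠ 0 ∧ a + b = c + d ∧ a + b ≠ 0 ∧
      f = quadricOne s a b c d} ∪
  {f | ∃ a b : ZMod p, a ≠ 0 ∧ b ≠ 0 ∧ f = quadricTwo s t a b}

/-- The ideal `I_{s,t}` of `ℂ[r_0, …, r_{p-1}]`. -/
noncomputable def quadricIdeal {p : ℕ} (s t : ZMod p → ℂ) : Ideal (MvPolynomial (ZMod p) ℂ) :=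
  Ideal.span (quadricSet s t)

/-- The degree `n` component of `ℂ[r_0, …, r_{p-1}] / I_{s,t}`: the image of the space of
homogeneous polynomials of degree `n`. -/
noncomputable def gradedPiece {p : ℕ} (s t : ZMod p → ℂ) (n : ℕ) :
    Submodule ℂ (MvPolynomial (ZMod p) ℂ ⧸ quadricIdeal s t) :=
  (homogeneousSubmodule (ZMod p) ℂ n).map
    (Ideal.Quotient.mkₐ ℂ (quadricIdeal s t)).toLinearMap

section

attribute [local instance] MvPolynomial.gradedAlgebra

/-- The ideal `I_{s,t}` is homogeneous, so that the quotient is graded by `gradedPiece`. -/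
theorem quadricIdeal_isHomogeneous {p : ℕ} (s t : ZMod p → ℂ) :
    (quadricIdeal s t).IsHomogeneous (homogeneousSubmodule (ZMod p) ℂ) := by
  have hXX : ∀ i j : ZMod p, (X i * X j : MvPolynomial (ZMod p) ℂ).IsHomogeneous 2 :=
    fun i j => (isHomogeneous_X ℂ i).mul (isHomogeneous_X ℂ j)
  have hC : ∀ (z : ℂ) (f : MvPolynomial (ZMod p) ℂ), f.IsHomogeneous 2 →
      (C z * f).IsHomogeneous 2 := fun z f hf => by
    simpa using (isHomogeneous_C (ZMod p) z).mul hf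
  refine Ideal.homogeneous_span _ _ ?_
  rintro f (⟨a, b, c, d, -, -, -, -, -, -, rfl⟩ | ⟨a, b, -, -, rfl⟩)
  · exact ⟨2, ((hXX a b).sub (hXX c d)).sub (hC _ _ (hXX 0 (a + b)))⟩
  · refine ⟨2, ((hXX a (-a)).sub (hXX b (-b))).sub (hC _ _ ?_)⟩
    rw [pow_two]
    exact hXX 0 0

end

/-! Put `e a = s a ^ 2 - 2 * t a`. Since `t` is even, the relation for `a`, `b`, `-(a + b)` says
that `(s a + s b - s (a + b)) ^ 2 = e a + e b + e (a + b)`. This is the law tying the slope of a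
chord of a Weierstrass cubic to the abscissae of its three points. Ordinates can be recovered from
the slopes, and all the points lie on one cubic `y ^ 2 = x ^ 3 + A x + B`, possibly singular
(`IsSlopeSystem.exists_cubic`).

Lower bound: on a smooth cubic the `r_a` would be sigma quotients, expanded at the origin in the
parameter `v = x ^ (-1/2)`. Here they are defined instead as power series by their logarithmic
derivatives, which makes sense for every `A`, `B`, and the quadrics follow from the addition law
(`IsSlopeSystem.exists_series`). The quadrics are also homogeneous for the grading of `r_a` by `a`
modulo `p`. So `r_a` can be sent to its series times the group element `a`, with `r_0` going to the
variable (`exists_algHom`).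

Upper bound: modulo `r_0`, a product of two variables of nonzero index depends only on the sum of
the indices. Hence in degree `n + 1` the products of `r_0 ^ (n - k)` with one chosen monomial of
degree `k + 1` and index sum `c`, for `k ≤ n` and `c` modulo `p`, span the component
(`IsSumDetermined.pow_eq_span`). There are `(n + 1) * p` of them. In the group algebra those with
the same `c` have distinct orders of vanishing, so they are independent
(`linearIndependent_stdMonomial`). -/

/-! ### From slopes to points on a Weierstrass cubic. -/

section Cubic

variable {p : ℕ} [Fact p.Prime] {s e : ZMod p → ℂ}

/-- The slope of the line through the points with parameters `a`, `b` and `-(a + b)`. -/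
noncomputable def secantSlope (s : ZMod p → ℂ) (a b : ZMod p) : ℂ := s a + s b - s (a + b)

/-- `s` is odd, `e` is even and the squares of the slopes are the sums of the abscissae. -/
structure IsSlopeSystem (s e : ZMod p → ℂ) : Prop where
  odd : ∀ a : ZMod p, a ≠ 0 → s (-a) = -s a
  even : ∀ a : ZMod p, a ≠ 0 → e (-a) = e a
  sq : ∀ a b : ZMod p, a ≠ 0 → b ≠ 0 → a + b ≠ 0 →
    secantSlope s a b ^ 2 = e a + e b + e (a + b)

theorem secantSlope_comm (s : ZMod p → ℂ) (a b : ZMod p) :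
    secantSlope s a b = secantSlope s b a := by
  unfold secantSlope; rw [add_comm a b]; ring

theorem IsSlopeSystem.secantSlope_neg (h : IsSlopeSystem s e) {a b : ZMod p}
    (ha : a ≠ 0) (hb : b ≠ 0) (hab : a + b ≠ 0) : secantSlope s (-a) (-b) = -secantSlope s a b := by
  have h1 : -a + -b = -(a + b) := by ring
  unfold secantSlope
  rw [h1, h.odd a ha, h.odd b hb, h.odd _ hab]; ring

theorem IsSlopeSystem.secantSlope_third (h : IsSlopeSystem s e) {a b : ZMod p}
    (hb : b ≠ 0) (hab : a + b ≠ 0) : secantSlope s a (-(a + b)) = secantSlope s a b := by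
  have h1 : a + -(a + b) = -b := by ring
  unfold secantSlope
  rw [h1, h.odd b hb, h.odd _ hab]; ring

/-- Each term is the difference of two ordinates computed as slope times difference of abscissae;
this is the compatibility needed for ordinates to exist. -/
theorem IsSlopeSystem.cocycle (h : IsSlopeSystem s e) {a b d : ZMod p} (ha : a ≠ 0) (hb : b ≠ 0)
    (hd : d ≠ 0) (hab : a + b ≠ 0) (hbd : b + d ≠ 0) (hda : d + a ≠ 0) :
    secantSlope s a b * (e a - e b) + secantSlope s b d * (e b - e d)
      + secantSlope s d a * (e d - e a) = 0 := by
  by_cases hs : a + b + d = 0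
  · have h1 : a + b = -d := by linear_combination hs
    have h2 : b + d = -a := by linear_combination hs
    have h3 : d + a = -b := by linear_combination hs
    unfold secantSlope
    rw [h1, h2, h3, h.odd a ha, h.odd b hb, h.odd d hd]; ring
  · have q1 := h.sq a b ha hb hab
    have q2 := h.sq b d hb hd hbd
    have q3 := h.sq d a hd ha hda
    have q4 := h.sq (a + b) d hab hd hs
    have q5 := h.sq (b + d) a hbd ha (by convert hs using 1; ring)
    have q6 := h.sq (d + a) b hda hb (by convert hs using 1; ring)
    have e5 : b + d + a = a + b + d := by ring
    have e6 : d + a + b = a + b + d := by ring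
    unfold secantSlope at *
    rw [e5] at q5
    rw [e6] at q6
    -- `S` minus the slope for `a`, `b` is the slope for `a + b`, `d`. Subtracting the two square
    -- laws leaves an equation linear in the first slope, and likewise for the cyclic permutations.
    set S := s a + s b + s d - s (a + b + d) with hS
    have r1 : 2 * S * (s a + s b - s (a + b)) = S ^ 2 + e a + e b - e d - e (a + b + d) := by
      rw [hS]; linear_combination q1 - q4
    have r2 : 2 * S * (s b + s d - s (b + d)) = S ^ 2 + e b + e d - e a - e (a + b + d) := by
      rw [hS]; linear_combination q2 - q5
    have r3 : 2 * S * (s d + s a - s (d + a)) = S ^ 2 + e d + e a - e b - e (a + b + d) := by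
      rw [hS]; linear_combination q3 - q6
    by_cases hS0 : S = 0
    · rw [hS0] at r1 r2 r3
      have t1 : e a = e b := by linear_combination (r2 - r3) / 2
      have t2 : e b = e d := by linear_combination (r3 - r1) / 2
      rw [t1, t2]; ring
    · refine mul_left_cancel₀ (mul_ne_zero two_ne_zero hS0) ?_
      linear_combination (e a - e b) * r1 + (e b - e d) * r2 + (e d - e a) * r3

theorem natCast_zmod_ne_zero {k : ℕ} (hk : 0 < k) (hkp : k < p) : (k : ZMod p) ≠ 0 := by
  rw [Ne, ZMod.natCast_eq_zero_iff]
  exact Nat.not_dvd_of_pos_of_lt hk hkp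

/-- The ordinate of the point with parameter `a`. -/
noncomputable def ordinate (s e : ZMod p → ℂ) (a : ZMod p) : ℂ :=
  (e a - e (2 * a)) * (3 * s a - s (3 * a)) / 2

theorem two_zmod_ne_zero (hp5 : 5 ≤ p) : (2 : ZMod p) ≠ 0 := by
  exact_mod_cast natCast_zmod_ne_zero (p := p) (k := 2) (by norm_num) (by omega)

theorem three_zmod_ne_zero (hp5 : 5 ≤ p) : (3 : ZMod p) ≠ 0 := by
  exact_mod_cast natCast_zmod_ne_zero (p := p) (k := 3) (by norm_num) (by omega)

/-- Chords through `a, b` and through `a, -b` give the difference and the sum of the two ordinates,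
hence twice the ordinate at `a`. The definition of `ordinate` is the choice `b = 2 * a`; the cocycle
identity shows that any other `b` gives the same value. -/
theorem IsSlopeSystem.two_mul_ordinate (hp5 : 5 ≤ p) (h : IsSlopeSystem s e) {a b : ZMod p}
    (ha : a ≠ 0) (hb : b ≠ 0) (hab : a + b ≠ 0) (hba : b - a ≠ 0) :
    2 * ordinate s e a = (e a - e b) * (secantSlope s a b - secantSlope s b (-a)) := by
  have h2 := mul_ne_zero (two_zmod_ne_zero hp5) ha
  have h3 := mul_ne_zero (three_zmod_ne_zero hp5) ha
  have hna : -a ≠ 0 := neg_ne_zero.2 ha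
  have key : 2 * ordinate s e a =
      (e a - e (2 * a)) * (secantSlope s a (2 * a) - secantSlope s (2 * a) (-a)) := by
    unfold ordinate secantSlope
    rw [show a + 2 * a = 3 * a by ring, show 2 * a + -a = a by ring, h.odd a ha]; ring
  -- The cocycle identity excludes `b = -2 * a`, where the claim is compared with `b = 2 * a`
  -- directly.
  by_cases hb2 : b + 2 * a = 0
  · have hb' : b = -(2 * a) := by linear_combination hb2
    rw [key, hb', h.even _ h2]
    congr 1
    unfold secantSlope
    rw [show a + 2 * a = 3 * a by ring, show 2 * a + -a = a by ring,
      show a + -(2 * a) = -a by ring, show -(2 * a) + -a = -(3 * a) by ring,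
      h.odd _ h2, h.odd _ ha, h.odd _ h3]
    ring
  · have c1 := h.cocycle ha hb h2 hab hb2 (by convert h3 using 1; ring)
    have c2 := h.cocycle hna hb h2 (by convert hba using 1; ring) hb2
      (by convert ha using 1; ring)
    rw [h.even a ha] at c2
    rw [key]
    rw [secantSlope_comm s (2 * a) a] at c1
    rw [secantSlope_comm s (-a) b] at c2
    linear_combination c2 - c1

theorem IsSlopeSystem.ordinate_neg (hp5 : 5 ≤ p) (h : IsSlopeSystem s e) {a : ZMod p}
    (ha : a ≠ 0) : ordinate s e (-a) = -ordinate s e a := by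
  have h2 := mul_ne_zero (two_zmod_ne_zero hp5) ha
  have h3 := mul_ne_zero (three_zmod_ne_zero hp5) ha
  unfold ordinate
  rw [mul_neg, mul_neg, h.even _ h2, h.even _ ha, h.odd _ ha, h.odd _ h3]; ring

theorem IsSlopeSystem.ordinate_sub (hp5 : 5 ≤ p) (h : IsSlopeSystem s e) {a b : ZMod p}
    (ha : a ≠ 0) (hb : b ≠ 0) (hab : a + b ≠ 0) :
    ordinate s e a - ordinate s e b = secantSlope s a b * (e a - e b) := by
  by_cases hba : b = a
  · rw [hba]; ring
  have hba' : b - a ≠ 0 := sub_ne_zero.2 hba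
  have hab' : a - b ≠ 0 := sub_ne_zero.2 (Ne.symm hba)
  have k1 := h.two_mul_ordinate hp5 ha hb hab hba'
  have k2 := h.two_mul_ordinate hp5 hb ha (by rwa [add_comm]) hab'
  have k3 := h.secantSlope_neg (neg_ne_zero.2 hb) ha (by convert hab' using 1; ring)
  rw [neg_neg, secantSlope_comm s (-b)] at k3
  rw [secantSlope_comm s b a] at k2
  linear_combination (k1 - k2) / 2 - (e a - e b) / 2 * k3

/-- The linear coefficient of the cubic through the points with parameters `a`, `b`. -/
noncomputable def cubicCoeff (s e : ZMod p → ℂ) (a b : ZMod p) : ℂ :=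
  secantSlope s a b * (ordinate s e a + ordinate s e b) - (e a ^ 2 + e a * e b + e b ^ 2)

theorem cubicCoeff_comm (s e : ZMod p → ℂ) (a b : ZMod p) :
    cubicCoeff s e a b = cubicCoeff s e b a := by
  unfold cubicCoeff; rw [secantSlope_comm]; ring

/-- Both slope terms equal the product of the two slopes with `e a - e b`; nothing is divided by `e
a - e b`, which may vanish. -/
theorem IsSlopeSystem.cubicCoeff_neg_right (hp5 : 5 ≤ p) (h : IsSlopeSystem s e) {a b : ZMod p}
    (ha : a ≠ 0) (hb : b ≠ 0) (hab : a + b ≠ 0) (hab' : a - b ≠ 0) :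
    cubicCoeff s e a (-b) = cubicCoeff s e a b := by
  have k1 := h.ordinate_sub hp5 ha hb hab
  have k2 := h.ordinate_sub hp5 ha (neg_ne_zero.2 hb) (by rwa [← sub_eq_add_neg])
  rw [h.ordinate_neg hp5 hb, h.even b hb] at k2
  unfold cubicCoeff
  rw [h.ordinate_neg hp5 hb, h.even b hb]
  linear_combination secantSlope s a (-b) * k1 - secantSlope s a b * k2

theorem IsSlopeSystem.cubicCoeff_third (hp5 : 5 ≤ p) (h : IsSlopeSystem s e) {a b : ZMod p}
    (ha : a ≠ 0) (hb : b ≠ 0) (hab : a + b ≠ 0) :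
    cubicCoeff s e a (-(a + b)) = cubicCoeff s e a b := by
  have k1 := h.ordinate_sub hp5 ha hb hab
  have k2 := h.ordinate_sub hp5 ha (neg_ne_zero.2 hab)
    (by rw [show a + -(a + b) = -b by ring]; exact neg_ne_zero.2 hb)
  have k3 := h.sq a b ha hb hab
  rw [h.secantSlope_third hb hab, h.even _ hab] at k2
  unfold cubicCoeff
  rw [h.secantSlope_third hb hab, h.even _ hab]
  linear_combination secantSlope s a b * k1 - secantSlope s a b * k2 + (e (a + b) - e b) * k3

theorem IsSlopeSystem.cubicCoeff_add (hp5 : 5 ≤ p) (h : IsSlopeSystem s e) {a b : ZMod p}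
    (ha : a ≠ 0) (hb : b ≠ 0) (hab : a + b ≠ 0) (hab2 : 2 * a + b ≠ 0) :
    cubicCoeff s e a (a + b) = cubicCoeff s e a b := by
  rw [← h.cubicCoeff_third hp5 ha hb hab]
  exact (h.cubicCoeff_neg_right hp5 ha hab (by convert hab2 using 1; ring)
    (by rw [show a - (a + b) = -b by ring]; exact neg_ne_zero.2 hb)).symm

/-- Iterating `cubicCoeff_add` from `b = a` reaches every multiple of `a` other than `0` and `-a`.
-/
theorem IsSlopeSystem.cubicCoeff_eq_self (hp5 : 5 ≤ p) (h : IsSlopeSystem s e) {a b : ZMod p}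
    (ha : a ≠ 0) (hb : b ≠ 0) (hab : a + b ≠ 0) : cubicCoeff s e a b = cubicCoeff s e a a := by
  have key : ∀ k : ℕ, k + 2 < p → cubicCoeff s e a ((k + 1 : ℕ) * a) = cubicCoeff s e a a := by
    intro k
    induction k with
    | zero => intro _; simp
    | succ k ih =>
      intro hk
      have hz : ∀ j : ℕ, 0 < j → j < p → (j : ZMod p) * a ≠ 0 := fun j h1 h2 =>
        mul_ne_zero (natCast_zmod_ne_zero h1 h2) ha
      rw [← ih (by omega)]
      have e1 : ((k + 1 + 1 : ℕ) : ZMod p) * a = a + ((k + 1 : ℕ) : ZMod p) * a := by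
        push_cast; ring
      have e2 : ((k + 1 + 1 + 1 : ℕ) : ZMod p) * a = 2 * a + ((k + 1 : ℕ) : ZMod p) * a := by
        push_cast; ring
      have n1 := hz (k + 1 + 1) (by omega) (by omega)
      have n2 := hz (k + 1 + 1 + 1) (by omega) (by omega)
      rw [e1] at n1 ⊢
      rw [e2] at n2
      exact h.cubicCoeff_add hp5 ha (hz (k + 1) (by omega) (by omega)) n1 n2
  have hv : ((b / a).val : ZMod p) * a = b := by
    rw [ZMod.natCast_val, ZMod.cast_id]; field_simp
  have hlt := ZMod.val_lt (b / a)
  have hv0 : (b / a).val ≠ 0 := by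
    intro h0
    rw [h0] at hv
    simp at hv
    exact hb hv.symm
  have hv1 : (b / a).val + 1 ≠ p := by
    intro h0
    have h4 : (((b / a).val + 1 : ℕ) : ZMod p) = 0 := by rw [h0]; simp
    apply hab
    push_cast at h4
    linear_combination a * h4 - hv
  obtain ⟨k, hk⟩ := Nat.exists_eq_succ_of_ne_zero hv0
  have := key k (by omega)
  rw [← Nat.succ_eq_add_one, ← hk, hv] at this
  exact this

theorem exists_zmod_ne (hp5 : 5 ≤ p) (x y z : ZMod p) :
    ∃ b : ZMod p, b ≠ 0 ∧ b ≠ x ∧ b ≠ y ∧ b ≠ z := by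
  have hc : ({0, x, y, z} : Finset (ZMod p)).card < Fintype.card (ZMod p) := by
    rw [ZMod.card]
    exact lt_of_le_of_lt Finset.card_le_four (by omega)
  obtain ⟨b, hb⟩ := Finset.exists_mem_notMem_of_card_lt_card (s := {0, x, y, z})
    (t := Finset.univ) (by rwa [Finset.card_univ])
  have := hb.2
  simp only [Finset.mem_insert, Finset.mem_singleton, not_or] at this
  exact ⟨b, this⟩

/-- By symmetry the value can be passed from `a` to `c` through any nonzero `d` different from `-a`
and `-c`. -/
theorem IsSlopeSystem.cubicCoeff_const (hp5 : 5 ≤ p) (h : IsSlopeSystem s e) {a b c : ZMod p}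
    (ha : a ≠ 0) (hb : b ≠ 0) (hab : a + b ≠ 0) (hc : c ≠ 0) :
    cubicCoeff s e a b = cubicCoeff s e c c := by
  obtain ⟨d, hd, hda, hdc, -⟩ := exists_zmod_ne hp5 (-a) (-c) 0
  have h1 : a + d ≠ 0 := fun h0 => hda (by linear_combination h0)
  have h2 : c + d ≠ 0 := fun h0 => hdc (by linear_combination h0)
  rw [h.cubicCoeff_eq_self hp5 ha hb hab, ← h.cubicCoeff_eq_self hp5 ha hd h1,
    cubicCoeff_comm, h.cubicCoeff_eq_self hp5 hd ha (by rwa [add_comm]),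
    ← h.cubicCoeff_eq_self hp5 hd hc (by rwa [add_comm]), cubicCoeff_comm,
    h.cubicCoeff_eq_self hp5 hc hd h2]

/-- The points `(e a, Y a)` lie on a common cubic `Y ^ 2 = X ^ 3 + A * X + B`, and the points with
parameters `a`, `b`, `-(a + b)` lie on a line of slope `secantSlope s a b`. -/
theorem IsSlopeSystem.exists_cubic (hp5 : 5 ≤ p) (h : IsSlopeSystem s e) :
    ∃ (Y : ZMod p → ℂ) (A B : ℂ), (∀ a, a ≠ 0 → Y (-a) = -Y a) ∧
      ∀ a b, a ≠ 0 → b ≠ 0 → a + b ≠ 0 → ∃ ν : ℂ,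
        Y a = secantSlope s a b * e a + ν ∧ Y b = secantSlope s a b * e b + ν ∧
        Y (a + b) = -(secantSlope s a b * e (a + b) + ν) ∧
        A = e a * e b + e b * e (a + b) + e (a + b) * e a + 2 * secantSlope s a b * ν ∧
        B = ν ^ 2 - e a * e b * e (a + b) := by
  set A := cubicCoeff s e 1 1 with hA
  have hB : ∀ a b : ZMod p, a ≠ 0 → b ≠ 0 → a + b ≠ 0 →
      ordinate s e a ^ 2 - e a ^ 3 - A * e a = ordinate s e b ^ 2 - e b ^ 3 - A * e b := by
    intro a b ha hb hab
    have k1 := h.cubicCoeff_const hp5 ha hb hab one_ne_zero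
    have k2 := h.ordinate_sub hp5 ha hb hab
    rw [← hA] at k1
    unfold cubicCoeff at k1
    linear_combination (e a - e b) * k1 + (ordinate s e a + ordinate s e b) * k2
  refine ⟨ordinate s e, A, ordinate s e 1 ^ 2 - e 1 ^ 3 - A * e 1,
    fun a ha => h.ordinate_neg hp5 ha, fun a b ha hb hab =>
    ⟨ordinate s e a - secantSlope s a b * e a, by ring, ?_, ?_, ?_, ?_⟩⟩
  · linear_combination -(h.ordinate_sub hp5 ha hb hab)
  · have k2 := h.ordinate_sub hp5 ha (neg_ne_zero.2 hab)
      (by rw [show a + -(a + b) = -b by ring]; exact neg_ne_zero.2 hb)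
    rw [h.secantSlope_third hb hab, h.even _ hab, h.ordinate_neg hp5 hab] at k2
    linear_combination k2
  · have k1 := h.cubicCoeff_const hp5 ha hb hab one_ne_zero
    have k2 := h.ordinate_sub hp5 ha hb hab
    have k3 := h.sq a b ha hb hab
    rw [← hA] at k1
    unfold cubicCoeff at k1
    linear_combination -k1 - secantSlope s a b * k2 + (e a + e b) * k3
  -- The constant terms at `1` and `a` are compared through `d`, since `a = -1` is possible.
  · obtain ⟨d, hd, hda, hd1, -⟩ := exists_zmod_ne hp5 (-a) (-1) 0
    have h1 := hB 1 d one_ne_zero hd (fun h0 => hd1 (by linear_combination h0))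
    have h2 := hB a d ha hd (fun h0 => hda (by linear_combination h0))
    have k1 := h.cubicCoeff_const hp5 ha hb hab one_ne_zero
    have k2 := h.ordinate_sub hp5 ha hb hab
    have k3 := h.sq a b ha hb hab
    rw [h1, ← h2]
    rw [← hA] at k1
    unfold cubicCoeff at k1
    linear_combination e a * k1 + e a * secantSlope s a b * k2 - e a * e b * k3

end Cubic

/-! ### From the quadratic relations to a slope system. -/

/-- The odd part `t a - t (-a)` is additive as long as no index vanishes. Adding up `p - 1` copies
of `a` multiplies it by `p - 1`, whereas replacing `a` by `-a` changes its sign, so `p` times it is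
zero. -/
theorem IsQuadraticSolution.t_neg {p : ℕ} [Fact p.Prime] (hp5 : 5 ≤ p) {s t : ZMod p → ℂ}
    (hst : IsQuadraticSolution p s t) {a : ZMod p} (ha : a ≠ 0) : t (-a) = t a := by
  have add : ∀ a b : ZMod p, a ≠ 0 → b ≠ 0 → a + b ≠ 0 →
      t (a + b) - t (-(a + b)) = (t a - t (-a)) + (t b - t (-b)) := by
    intro a b ha hb hab
    have h1 := hst.rel a b (-(a + b)) ha hb (neg_ne_zero.2 hab) (by ring)
    have h2 := hst.rel (-a) (-b) (a + b) (neg_ne_zero.2 ha) (neg_ne_zero.2 hb) hab (by ring)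
    rw [hst.odd _ hab] at h1
    rw [hst.odd _ ha, hst.odd _ hb] at h2
    linear_combination h2 - h1
  have key : ∀ k : ℕ, k + 1 < p →
      t ((k + 1 : ℕ) * a) - t (-((k + 1 : ℕ) * a)) = (k + 1 : ℕ) * (t a - t (-a)) := by
    intro k
    induction k with
    | zero => intro _; simp
    | succ k ih =>
      intro hk
      have hz : ∀ j : ℕ, 0 < j → j < p → (j : ZMod p) * a ≠ 0 := fun j h1 h2 =>
        mul_ne_zero (natCast_zmod_ne_zero h1 h2) ha
      have e1 : ((k + 1 + 1 : ℕ) : ZMod p) * a = ((k + 1 : ℕ) : ZMod p) * a + a := by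
        push_cast; ring
      have n1 := hz (k + 1 + 1) (by omega) (by omega)
      rw [e1] at n1 ⊢
      rw [add _ _ (hz _ (by omega) (by omega)) ha n1, ih (by omega)]
      push_cast; ring
  have h1 := key (p - 2) (by omega)
  have h2 : ((p - 2 + 1 : ℕ) : ZMod p) = -1 := by
    have : ((p - 2 + 1 + 1 : ℕ) : ZMod p) = 0 := by
      rw [show p - 2 + 1 + 1 = p by omega]; simp
    push_cast at this ⊢
    linear_combination this
  have h3 : ((p - 2 + 1 : ℕ) : ℂ) = p - 1 := by
    rw [show p - 2 + 1 = p - 1 by omega, Nat.cast_sub (by omega)]; simp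
  rw [h2, h3, neg_one_mul, neg_neg] at h1
  have h4 : (p : ℂ) * (t (-a) - t a) = 0 := by linear_combination h1
  have hp0 : (p : ℂ) ≠ 0 := by exact_mod_cast (by omega : p ≠ 0)
  exact sub_eq_zero.1 ((mul_eq_zero.1 h4).resolve_left hp0)

theorem IsQuadraticSolution.isSlopeSystem {p : ℕ} [Fact p.Prime] (hp5 : 5 ≤ p)
    {s t : ZMod p → ℂ} (hst : IsQuadraticSolution p s t) :
    IsSlopeSystem s (fun a => s a ^ 2 - 2 * t a) where
  odd := hst.odd
  even a ha := by simp only [hst.odd a ha, hst.t_neg hp5 ha]; ring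
  sq a b ha hb hab := by
    have h1 := hst.rel a b (-(a + b)) ha hb (neg_ne_zero.2 hab) (by ring)
    rw [hst.odd _ hab, hst.t_neg hp5 hab] at h1
    unfold secantSlope
    linear_combination 2 * h1

/-! ### Power series with prescribed logarithmic derivatives. -/

section Series

namespace PowerSeries

theorem exists_derivative_eq_mul (k : PowerSeries ℂ) :
    ∃ w : PowerSeries ℂ, constantCoeff w = 1 ∧ derivative ℂ w = k * w := by
  -- The antiderivative of `k`; division by zero makes its constant term `0`. The solution is its
  -- exponential.
  set g : PowerSeries ℂ := mk fun n => coeff (n - 1) k / n with hg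
  have hg0 : constantCoeff g = 0 := by
    rw [← coeff_zero_eq_constantCoeff_apply, hg, coeff_mk]; simp
  have hsub : HasSubst g := HasSubst.of_constantCoeff_zero' hg0
  have hdg : derivative ℂ g = k := by
    ext n
    rw [coeff_derivative, hg, coeff_mk]
    have : (n : ℂ) + 1 ≠ 0 := by exact_mod_cast Nat.succ_ne_zero n
    simp only [Nat.add_sub_cancel]
    push_cast
    field_simp
  refine ⟨(exp ℂ).subst g, ?_, ?_⟩
  · have h1 := constantCoeff_subst_eq_zero hg0 (exp ℂ - 1) (by simp)
    rw [← coe_substAlgHom hsub, map_sub, map_one, map_sub, sub_eq_zero,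
      coe_substAlgHom hsub] at h1
    exact h1.trans (by simp)
  · rw [derivative_subst hsub, hdg, derivative_exp, mul_comm]

/-- `U / V` has derivative zero and constant term `1`. -/
theorem eq_of_derivative_mul_eq {U V : PowerSeries ℂ} (hU : constantCoeff U = 1)
    (hV : constantCoeff V = 1) (h : derivative ℂ U * V = U * derivative ℂ V) : U = V := by
  have hV0 : constantCoeff V ≠ 0 := by rw [hV]; exact one_ne_zero
  have hVV : V * V⁻¹ = 1 := PowerSeries.mul_inv_cancel V hV0
  have h1 : U * V⁻¹ = 1 := by
    refine derivative.ext ?_ (by simp [hU, hV])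
    rw [Derivation.leibniz, derivative_inv', derivative_one, smul_eq_mul, smul_eq_mul]
    linear_combination V⁻¹ ^ 2 * h - (derivative ℂ U * V⁻¹) * hVV
  calc U = U * V⁻¹ * V := by rw [mul_assoc, mul_comm V⁻¹, hVV, mul_one]
    _ = V := by rw [h1, one_mul]

theorem exists_mul_derivative_eq {g : PowerSeries ℂ} (hg : constantCoeff g = 1)
    (k : PowerSeries ℂ) :
    ∃ w : PowerSeries ℂ, constantCoeff w = 1 ∧ g * derivative ℂ w = k * w := by
  obtain ⟨w, hw, hd⟩ := exists_derivative_eq_mul (k * g⁻¹)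
  refine ⟨w, hw, ?_⟩
  have : g * g⁻¹ = 1 := PowerSeries.mul_inv_cancel g (by rw [hg]; exact one_ne_zero)
  rw [hd]
  linear_combination (k * w) * this

theorem exists_sq_eq {f : PowerSeries ℂ} (hf : constantCoeff f = 1) :
    ∃ q : PowerSeries ℂ, constantCoeff q = 1 ∧ q ^ 2 = f := by
  obtain ⟨q, hq, hd⟩ := exists_mul_derivative_eq hf (C (1 / 2) * derivative ℂ f)
  refine ⟨q, hq, eq_of_derivative_mul_eq (by simp [hq]) hf ?_⟩
  have h2 : (2 : PowerSeries ℂ) * C (1 / 2 : ℂ) = 1 := by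
    rw [← map_ofNat C 2, ← map_mul]; simp
  rw [derivative_pow]
  push_cast
  linear_combination (2 * q) * hd + (q ^ 2 * derivative ℂ f) * h2

end PowerSeries

/-- Logarithmic derivatives of both sides of the addition formula agree. -/
theorem addition_logDeriv {R : Type*} [CommRing R] {sa sb ea eb l n v q Pa Pb Pc ec A B : R}
    (hec : ec = l ^ 2 - ea - eb) (hA : A = ea * eb + eb * ec + ec * ea + 2 * l * n)
    (hB : B = n ^ 2 - ea * eb * ec) (hq : q ^ 2 = 1 + A * v ^ 4 + B * v ^ 6)
    (hPa : Pa = 1 - ea * v ^ 2) (hPb : Pb = 1 - eb * v ^ 2) (hPc : Pc = 1 - ec * v ^ 2) :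
    ((sa * Pa - ea * q * v + (l * ea + n) * v ^ 2) * Pb * Pc
      + (sb * Pb - eb * q * v + (l * eb + n) * v ^ 2) * Pa * Pc
      - ((sa + sb - l) * Pc - ec * q * v - (l * ec + n) * v ^ 2) * Pa * Pb
      - 2 * ec * v * q * Pa * Pb) * (q + l * v + n * v ^ 3)
    = Pa * Pb * Pc * (2 * A * v ^ 3 + 3 * B * v ^ 5 + q * (l + 3 * n * v ^ 2)) := by
  subst hPa hPb hPc hA hB hec
  linear_combination (-v * (ea * (1 - eb * v ^ 2) * (1 - (l ^ 2 - ea - eb) * v ^ 2)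
    + eb * (1 - ea * v ^ 2) * (1 - (l ^ 2 - ea - eb) * v ^ 2)
    + (l ^ 2 - ea - eb) * (1 - ea * v ^ 2) * (1 - eb * v ^ 2))) * hq

/-- Power series satisfying the quadratic relations, with `X` in the place of `r_0`. -/
theorem IsSlopeSystem.exists_series {p : ℕ} [Fact p.Prime] (hp5 : 5 ≤ p) {s e : ZMod p → ℂ}
    (h : IsSlopeSystem s e) :
    ∃ w : ZMod p → PowerSeries ℂ, (∀ a, PowerSeries.constantCoeff (w a) = 1) ∧
      (∀ a b c d, a ≠ 0 → b ≠ 0 → c ≠ 0 → d ≠ 0 → a + b = c + d → a + b ≠ 0 →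
        w a * w b - w c * w d =
          PowerSeries.C (s a + s b - s c - s d) * (PowerSeries.X * w (a + b))) ∧
      ∀ a, a ≠ 0 → w a * w (-a) = 1 - PowerSeries.C (e a) * PowerSeries.X ^ 2 := by
  obtain ⟨Y, A, B, hY, hline⟩ := h.exists_cubic hp5
  obtain ⟨q, hq0, hq⟩ := PowerSeries.exists_sq_eq
    (f := 1 + PowerSeries.C A * PowerSeries.X ^ 4 + PowerSeries.C B * PowerSeries.X ^ 6) (by simp)
  set P : ZMod p → PowerSeries ℂ := fun a => 1 - PowerSeries.C (e a) * PowerSeries.X ^ 2 with hP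
  have hP0 : ∀ a, PowerSeries.constantCoeff (P a) = 1 := fun a => by simp [hP]
  have hPne : ∀ a, P a ≠ 0 := fun a h0 => by simpa [h0] using hP0 a
  have hqne : q ≠ 0 := fun h0 => by simp [h0] at hq0
  -- With `x = X ^ (-2)` and `y = q * X ^ (-3)` one has `y ^ 2 = x ^ 3 + A x + B` and `P a = X ^ 2 *
  -- (x - e a)`. On a smooth cubic with uniformizing parameter `z`, `q` is `dX/dz` and `w a` is `X *
  -- σ(z + z_a) / (σ(z) * σ(z_a))` times an exponential in `z`; the formula is its logarithmic
  -- derivative.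
  choose w hw hdw using fun a => PowerSeries.exists_mul_derivative_eq (g := q * P a)
    (by simp [hq0, hP0]) (PowerSeries.C (s a) * P a - PowerSeries.C (e a) * q * PowerSeries.X
      + PowerSeries.C (Y a) * PowerSeries.X ^ 2)
  have hdP : ∀ a, PowerSeries.derivative ℂ (P a) =
      -2 * PowerSeries.C (e a) * PowerSeries.X := fun a => by
    simp only [hP, map_sub, Derivation.leibniz, PowerSeries.derivative_pow,
      PowerSeries.derivative_X, PowerSeries.derivative_C, PowerSeries.derivative_one, smul_eq_mul]
    push_cast; ring
  have h2ne : (2 : PowerSeries ℂ) ≠ 0 := by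
    rw [← map_ofNat PowerSeries.C 2]
    exact (map_ne_zero_iff _ PowerSeries.C_injective).2 two_ne_zero
  have hdq : q * PowerSeries.derivative ℂ q = 2 * PowerSeries.C A * PowerSeries.X ^ 3
      + 3 * PowerSeries.C B * PowerSeries.X ^ 5 := by
    have h1 := congrArg (PowerSeries.derivative ℂ) hq
    simp only [map_add, Derivation.leibniz, PowerSeries.derivative_pow,
      PowerSeries.derivative_X, PowerSeries.derivative_C, PowerSeries.derivative_one,
      smul_eq_mul] at h1
    push_cast at h1
    refine mul_left_cancel₀ h2ne ?_
    linear_combination h1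
  refine ⟨w, hw, ?_, ?_⟩
  -- The last factor is `X ^ 3 * (y + l x + ν)`, where `l x + ν` defines the chord through the
  -- points `a` and `b`. Apart from `a + b`, it depends on `a` and `b` only through the slope, so
  -- subtracting two instances gives the first family of relations.
  · have add : ∀ a b, a ≠ 0 → b ≠ 0 → a + b ≠ 0 → w a * w b * P (a + b) =
        w (a + b) * (PowerSeries.C (secantSlope s a b) * PowerSeries.X * P (a + b) + q
          - PowerSeries.C (Y (a + b)) * PowerSeries.X ^ 3) := by
      intro a b ha hb hab
      obtain ⟨ν, hYa, hYb, hYc, hA, hB⟩ := hline a b ha hb hab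
      have hsq := h.sq a b ha hb hab
      set l := secantSlope s a b with hl
      have hsc : s (a + b) = s a + s b - l := by rw [hl]; unfold secantSlope; ring
      have hec : e (a + b) = l ^ 2 - e a - e b := by linear_combination -hsq
      have hN : PowerSeries.C l * PowerSeries.X * P (a + b) + q
          - PowerSeries.C (Y (a + b)) * PowerSeries.X ^ 3
          = q + PowerSeries.C l * PowerSeries.X + PowerSeries.C ν * PowerSeries.X ^ 3 := by
        simp only [hP, hYc, map_neg, map_add, map_mul]; ring
      rw [hN]
      have key := addition_logDeriv (R := PowerSeries ℂ) (sa := PowerSeries.C (s a))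
        (sb := PowerSeries.C (s b))
        (ea := PowerSeries.C (e a)) (eb := PowerSeries.C (e b)) (ec := PowerSeries.C (e (a + b)))
        (l := PowerSeries.C l) (n := PowerSeries.C ν) (v := PowerSeries.X) (q := q)
        (Pa := P a) (Pb := P b) (Pc := P (a + b)) (A := PowerSeries.C A) (B := PowerSeries.C B)
        (by rw [hec]; simp) (by rw [hA]; simp [map_ofNat PowerSeries.C 2]) (by rw [hB]; simp)
        hq rfl rfl rfl
      have da := hdw a
      have db := hdw b
      have dc := hdw (a + b)
      have dP := hdP (a + b)
      rw [hYa, map_add, map_mul] at da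
      rw [hYb, map_add, map_mul] at db
      rw [hYc, hsc] at dc
      simp only [map_add, map_mul, map_neg, map_sub] at dc
      refine PowerSeries.eq_of_derivative_mul_eq (by simp [hw, hP0]) (by simp [hw, hq0]) ?_
      have hne : q * P a * P b * P (a + b) ≠ 0 :=
        mul_ne_zero (mul_ne_zero (mul_ne_zero hqne (hPne _)) (hPne _)) (hPne _)
      refine mul_left_cancel₀ hne ?_
      simp only [map_add, Derivation.leibniz, PowerSeries.derivative_pow,
        PowerSeries.derivative_X, PowerSeries.derivative_C, smul_eq_mul, dP]
      push_cast
      generalize PowerSeries.derivative ℂ (w a) = wa' at *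
      generalize PowerSeries.derivative ℂ (w b) = wb' at *
      generalize PowerSeries.derivative ℂ (w (a + b)) = wc' at *
      generalize PowerSeries.derivative ℂ q = q' at *
      generalize P a = Pa at *
      generalize P b = Pb at *
      generalize P (a + b) = Pc at *
      generalize w a = wa at *
      generalize w b = wb at *
      generalize w (a + b) = wc at *
      generalize (PowerSeries.X : PowerSeries ℂ) = v at *
      generalize PowerSeries.C l = l' at *
      generalize PowerSeries.C ν = n' at *
      linear_combination (wa * wb * wc * Pc) * key
        + (wb * Pb * Pc ^ 2 * wc * (q + l' * v + n' * v ^ 3)) * da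
        + (wa * Pa * Pc ^ 2 * wc * (q + l' * v + n' * v ^ 3)) * db
        - (wa * wb * Pa * Pb * Pc * (q + l' * v + n' * v ^ 3)) * dc
        - (wa * wb * wc * Pa * Pb * Pc ^ 2) * hdq
    intro a b c d ha hb hc hd habcd hab
    have h1 := add a b ha hb hab
    have h2 := add c d hc hd (habcd ▸ hab)
    rw [← habcd] at h2
    unfold secantSlope at h1 h2
    rw [← habcd] at h2
    refine mul_right_cancel₀ (hPne (a + b)) ?_
    simp only [map_sub, map_add] at h1 h2 ⊢
    linear_combination h1 - h2
  · intro a ha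
    refine PowerSeries.eq_of_derivative_mul_eq (by simp [hw]) (hP0 a) ?_
    have da := hdw a
    have db := hdw (-a)
    have hPn : P (-a) = P a := by simp only [hP, h.even a ha]
    rw [h.odd a ha, h.even a ha, hY a ha, hPn] at db
    simp only [map_neg] at db
    have dP := hdP a
    change PowerSeries.derivative ℂ (w a * w (-a)) * P a =
      w a * w (-a) * PowerSeries.derivative ℂ (P a)
    refine mul_left_cancel₀ hqne ?_
    rw [dP, Derivation.leibniz, smul_eq_mul, smul_eq_mul]
    linear_combination w (-a) * da + w a * db

end Series

/-! ### Standard monomials span. -/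

section StandardMonomials

variable {p : ℕ} {R : Type*} [CommRing R]

/-- An index different from `0` and `c`. -/
def pivot (c : ZMod p) : ZMod p := if c = 1 then 2 else 1

/-- The chosen product of `k + 1` of the elements `x a` whose indices sum to `c`. -/
def stdMonomial (x : ZMod p → R) : ℕ → ZMod p → R
  | 0, c => x c
  | k + 1, c => x (pivot c) * stdMonomial x k (c - pivot c)

theorem map_stdMonomial {S F : Type*} [CommRing S] [FunLike F R S] [RingHomClass F R S] (f : F)
    (x : ZMod p → R) (k : ℕ) (c : ZMod p) :
    f (stdMonomial x k c) = stdMonomial (fun a => f (x a)) k c := by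
  induction k generalizing c with
  | zero => rfl
  | succ k ih => simp only [stdMonomial, map_mul, ih]

theorem pivot_ne_zero [Fact p.Prime] (hp5 : 5 ≤ p) (c : ZMod p) : pivot c ≠ 0 := by
  unfold pivot
  split_ifs
  · exact two_zmod_ne_zero hp5
  · exact one_ne_zero

theorem sub_pivot_ne_zero [Fact p.Prime] (c : ZMod p) : c - pivot c ≠ 0 := by
  unfold pivot
  split_ifs with h
  · rw [h]
    intro h0
    exact one_ne_zero (α := ZMod p) (by linear_combination -h0)
  · exact sub_ne_zero.2 h

variable [Algebra ℂ R]

theorem stdMonomial_mem (x : ZMod p → R) (k : ℕ) (c : ZMod p) :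
    stdMonomial x k c ∈ Submodule.span ℂ (Set.range x) ^ (k + 1) := by
  induction k generalizing c with
  | zero => rw [zero_add, pow_one]; exact Submodule.subset_span ⟨c, rfl⟩
  | succ k ih =>
    rw [pow_succ']
    exact Submodule.mul_mem_mul (Submodule.subset_span ⟨_, rfl⟩) (ih _)

/-- The multiples of `x 0` of degree `k + 1`. -/
def zeroMultiples (x : ZMod p → R) (k : ℕ) : Submodule ℂ R :=
  (Submodule.span ℂ (Set.range x) ^ k).map (LinearMap.mulLeft ℂ (x 0))

theorem mul_mem_zeroMultiples {x : ZMod p → R} {k : ℕ} {f : R} (hf : f ∈ zeroMultiples x k)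
    (a : ZMod p) : x a * f ∈ zeroMultiples x (k + 1) := by
  obtain ⟨g, hg, rfl⟩ := hf
  refine ⟨x a * g, ?_, ?_⟩
  · simp only [SetLike.mem_coe] at hg ⊢
    rw [pow_succ']
    exact Submodule.mul_mem_mul (Submodule.subset_span ⟨_, rfl⟩) hg
  · simp only [LinearMap.mulLeft_apply]; ring

/-- Modulo `x 0`, products of two of the `x a`, `a ≠ 0`, depend only on the sum of the indices. -/
def IsSumDetermined (x : ZMod p → R) : Prop :=
  ∀ a b c d : ZMod p, a ≠ 0 → b ≠ 0 → c ≠ 0 → d ≠ 0 → a + b = c + d →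
    x a * x b - x c * x d ∈ zeroMultiples x 1

variable [Fact p.Prime]

/-- Modulo `x 0`, a factor `x a` can be exchanged for `x b` by extracting both from the monomial,
provided that the remaining index sum is nonzero. That proviso matters only when a single factor
remains, which would be `x 0`. -/
theorem IsSumDetermined.mul_stdMonomial_aux (hp5 : 5 ≤ p) {x : ZMod p → R}
    (hx : IsSumDetermined x) (k : ℕ) {a d : ZMod p} (ha : a ≠ 0) (hd : d ≠ 0) :
    x a * stdMonomial x k d - stdMonomial x (k + 1) (a + d) ∈ zeroMultiples x (k + 1) ∧
      ∀ d' : ZMod p, x a * stdMonomial x (k + 1) d' - stdMonomial x (k + 2) (a + d') ∈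
        zeroMultiples x (k + 2) := by
  have step : ∀ k, (∀ a d : ZMod p, a ≠ 0 → d ≠ 0 →
      x a * stdMonomial x k d - stdMonomial x (k + 1) (a + d) ∈ zeroMultiples x (k + 1)) →
      ∀ a d : ZMod p, a ≠ 0 →
        x a * stdMonomial x (k + 1) d - stdMonomial x (k + 2) (a + d) ∈
          zeroMultiples x (k + 2) := by
    intro k hk
    have swap : ∀ a b c : ZMod p, a ≠ 0 → b ≠ 0 → c - a - b ≠ 0 →
        x a * stdMonomial x (k + 1) (c - a) - x b * stdMonomial x (k + 1) (c - b) ∈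
          zeroMultiples x (k + 2) := by
      intro a b c ha hb hc
      have h1 := mul_mem_zeroMultiples (hk b (c - a - b) hb hc) a
      have h2 := mul_mem_zeroMultiples (hk a (c - a - b) ha hc) b
      rw [show b + (c - a - b) = c - a by ring] at h1
      rw [show a + (c - a - b) = c - b by ring] at h2
      convert Submodule.sub_mem _ h2 h1 using 1
      ring
    intro a d ha
    -- A direct exchange of `a` for the pivot may leave index sum zero; passing through this `b`
    -- avoids it twice.
    obtain ⟨b, hb, hb1, hb2, -⟩ := exists_zmod_ne hp5 d (a + d - pivot (a + d)) 0
    have h1 := swap a b (a + d) ha hb (fun h0 => hb1 (by linear_combination -h0))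
    have h2 := swap b (pivot (a + d)) (a + d) hb (pivot_ne_zero hp5 _)
      (fun h0 => hb2 (by linear_combination -h0))
    rw [add_sub_cancel_left] at h1
    have h3 : stdMonomial x (k + 2) (a + d) =
        x (pivot (a + d)) * stdMonomial x (k + 1) (a + d - pivot (a + d)) := rfl
    rw [h3]
    convert Submodule.add_mem _ h1 h2 using 1
    ring
  have base : ∀ k, ∀ a d : ZMod p, a ≠ 0 → d ≠ 0 →
      x a * stdMonomial x k d - stdMonomial x (k + 1) (a + d) ∈ zeroMultiples x (k + 1) := by
    intro k
    induction k with
    | zero =>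
      intro a d ha hd
      exact hx _ _ _ _ ha hd (pivot_ne_zero hp5 _) (sub_pivot_ne_zero _) (by ring)
    | succ k ih => exact fun a d ha _ => step k ih a d ha
  exact ⟨base k a d ha hd, fun d' => step k (base k) a d' ha⟩

theorem IsSumDetermined.mul_stdMonomial (hp5 : 5 ≤ p) {x : ZMod p → R}
    (hx : IsSumDetermined x) (k : ℕ) {a : ZMod p} (ha : a ≠ 0) (d : ZMod p) :
    x a * stdMonomial x k d ∈ Submodule.span ℂ {stdMonomial x (k + 1) (a + d)} ⊔
      zeroMultiples x (k + 1) := by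
  have of_sub : x a * stdMonomial x k d - stdMonomial x (k + 1) (a + d) ∈
      zeroMultiples x (k + 1) → x a * stdMonomial x k d ∈
      Submodule.span ℂ {stdMonomial x (k + 1) (a + d)} ⊔ zeroMultiples x (k + 1) := fun h => by
    rw [← add_sub_cancel (stdMonomial x (k + 1) (a + d)) (x a * stdMonomial x k d)]
    exact Submodule.add_mem_sup (Submodule.mem_span_singleton_self _) h
  cases k with
  | zero =>
    -- Here the standard monomial is `x 0` itself, so the product is a multiple of `x 0`.
    by_cases hd : d = 0
    · refine Submodule.mem_sup_right ⟨x a, ?_, ?_⟩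
      · simpa using Submodule.subset_span (Set.mem_range_self a)
      · rw [hd]; simp only [LinearMap.mulLeft_apply, stdMonomial]; ring
    · exact of_sub (hx.mul_stdMonomial_aux hp5 0 ha hd).1
  | succ k => exact of_sub ((hx.mul_stdMonomial_aux hp5 k ha ha).2 d)

/-- Multiplying a spanning element by `x a` yields another one up to a multiple of `x 0`, whose
cofactor has lower degree and is covered by strong induction. -/
theorem IsSumDetermined.pow_le_span (hp5 : 5 ≤ p) {x : ZMod p → R}
    (hx : IsSumDetermined x) (n : ℕ) : Submodule.span ℂ (Set.range x) ^ (n + 1) ≤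
      Submodule.span ℂ {f | ∃ i k c, i + k = n ∧ f = x 0 ^ i * stdMonomial x k c} := by
  induction n using Nat.strong_induction_on with
  | _ n ih =>
  cases n with
  | zero =>
    rw [zero_add, pow_one]
    refine Submodule.span_mono ?_
    rintro _ ⟨c, rfl⟩
    exact ⟨0, 0, c, rfl, by simp [stdMonomial]⟩
  | succ n =>
    set W := Submodule.span ℂ
      {f | ∃ i k c, i + k = n + 1 ∧ f = x 0 ^ i * stdMonomial x k c} with hW
    have hmul : ∀ i k, i + k = n → ∀ f ∈ zeroMultiples x (k + 1), x 0 ^ i * f ∈ W := by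
      rintro i k hik _ ⟨g, hg, rfl⟩
      have hg' := ih k (by omega) hg
      have : (Submodule.span ℂ {f | ∃ i k' c, i + k' = k ∧ f = x 0 ^ i * stdMonomial x k' c}) ≤
          W.comap (LinearMap.mulLeft ℂ (x 0 ^ (i + 1))) := by
        refine Submodule.span_le.2 ?_
        rintro _ ⟨j, k', c, hj, rfl⟩
        refine Submodule.subset_span ⟨i + 1 + j, k', c, by omega, ?_⟩
        simp only [LinearMap.mulLeft_apply]; ring
      have h3 := this hg'
      simp only [Submodule.mem_comap, LinearMap.mulLeft_apply] at h3 ⊢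
      convert h3 using 1; ring
    rw [pow_succ']
    refine (mul_le_mul' le_rfl (ih n (by omega))).trans ?_
    rw [Submodule.span_mul_span]
    refine Submodule.span_le.2 ?_
    rintro _ ⟨_, ⟨a, rfl⟩, _, ⟨i, k, c, hik, rfl⟩, rfl⟩
    simp only [SetLike.mem_coe]
    by_cases ha : a = 0
    · refine Submodule.subset_span ⟨i + 1, k, c, by omega, ?_⟩
      rw [ha]; ring
    · obtain ⟨u, hu, z, hz, huz⟩ := Submodule.mem_sup.1 (hx.mul_stdMonomial hp5 k ha c)
      obtain ⟨r, rfl⟩ := Submodule.mem_span_singleton.1 hu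
      have h2 : x a * (x 0 ^ i * stdMonomial x k c) =
          r • (x 0 ^ i * stdMonomial x (k + 1) (a + c)) + x 0 ^ i * z := by
        rw [mul_left_comm, ← huz, mul_add, mul_smul_comm]
      rw [h2]
      exact Submodule.add_mem _ (Submodule.smul_mem _ _
        (Submodule.subset_span ⟨i, k + 1, a + c, by omega, rfl⟩)) (hmul i k hik z hz)

theorem IsSumDetermined.pow_eq_span (hp5 : 5 ≤ p) {x : ZMod p → R}
    (hx : IsSumDetermined x) (n : ℕ) : Submodule.span ℂ (Set.range x) ^ (n + 1) =
      Submodule.span ℂ (Set.range fun z : Fin (n + 1) × ZMod p =>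
        x 0 ^ (n - z.1) * stdMonomial x z.1 z.2) := by
  refine le_antisymm ((hx.pow_le_span hp5 n).trans (Submodule.span_mono ?_))
    (Submodule.span_le.2 ?_)
  · rintro _ ⟨i, k, c, hik, rfl⟩
    refine ⟨(⟨k, by omega⟩, c), ?_⟩
    simp only
    rw [show n - k = i by omega]
  · rintro _ ⟨⟨k, c⟩, rfl⟩
    have h1 := Submodule.mul_mem_mul (Submodule.pow_mem_pow
      (M := Submodule.span ℂ (Set.range x)) (x := x 0) (Submodule.subset_span ⟨0, rfl⟩)
      (n - k)) (stdMonomial_mem x k c)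
    rw [← pow_add] at h1
    rwa [show n - (k : ℕ) + (k + 1) = n + 1 by omega] at h1

end StandardMonomials

/-! ### Independence by orders of vanishing. -/

section LowerBound

/-- In a nontrivial relation the term of least order cannot be cancelled. -/
theorem PowerSeries.linearIndependent_of_X_pow_mul {ι : Type*} [Fintype ι]
    {h u : ι → PowerSeries ℂ} {d : ι → ℕ} (hd : Function.Injective d)
    (hu : ∀ i, constantCoeff (u i) = 1) (hh : ∀ i, h i = X ^ d i * u i) :
    LinearIndependent ℂ h := by
  rw [Fintype.linearIndependent_iff]
  intro g hg
  by_contra! hne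
  obtain ⟨j, hj⟩ := hne
  obtain ⟨i, hi, hmin⟩ := Finset.exists_min_image (Finset.univ.filter fun i => g i ≠ 0) d
    ⟨j, by simpa using hj⟩
  simp only [Finset.mem_filter, Finset.mem_univ, true_and] at hi hmin
  have h1 := congrArg (coeff (d i)) hg
  rw [map_sum, Finset.sum_eq_single i] at h1
  · rw [hh, map_smul, coeff_X_pow_mul', if_pos le_rfl, Nat.sub_self,
      coeff_zero_eq_constantCoeff_apply, hu] at h1
    simp at h1
    exact hi h1
  · intro k _ hk
    by_cases hgk : g k = 0
    · simp [hgk]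
    · have hlt : d i < d k := lt_of_le_of_ne (hmin k hgk) fun h => hk (hd h).symm
      rw [hh, map_smul, coeff_X_pow_mul', if_neg (by omega), smul_zero]
  · simp

variable {p : ℕ}

/-- All factors have nonzero index, hence constant term `1`, except when `k = 0` and `c = 0`, where
the monomial is `w 0 = X`. -/
theorem exists_stdMonomial_single [Fact p.Prime] (hp5 : 5 ≤ p) {w : ZMod p → PowerSeries ℂ}
    (hw0 : w 0 = PowerSeries.X) (hw : ∀ a, a ≠ 0 → PowerSeries.constantCoeff (w a) = 1)
    (k : ℕ) (c : ZMod p) : ∃ u : PowerSeries ℂ, PowerSeries.constantCoeff u = 1 ∧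
      stdMonomial (fun a => AddMonoidAlgebra.single a (w a)) k c =
        AddMonoidAlgebra.single c (PowerSeries.X ^ (if k = 0 ∧ c = 0 then 1 else 0) * u) := by
  induction k generalizing c with
  | zero =>
    by_cases hc : c = 0
    · exact ⟨1, by simp, by simp [stdMonomial, hc, hw0]⟩
    · exact ⟨w c, hw c hc, by simp [stdMonomial, hc]⟩
  | succ k ih =>
    obtain ⟨u, hu, hs⟩ := ih (c - pivot c)
    refine ⟨w (pivot c) * u, by rw [map_mul, hu, hw _ (pivot_ne_zero hp5 c), mul_one], ?_⟩
    rw [stdMonomial, hs, AddMonoidAlgebra.single_mul_single]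
    simp [sub_pivot_ne_zero]

theorem linearIndependent_stdMonomial [Fact p.Prime] (hp5 : 5 ≤ p) {w : ZMod p → PowerSeries ℂ}
    (hw0 : w 0 = PowerSeries.X) (hw : ∀ a, a ≠ 0 → PowerSeries.constantCoeff (w a) = 1)
    (n : ℕ) : LinearIndependent ℂ fun z : Fin (n + 1) × ZMod p =>
      (AddMonoidAlgebra.single 0 (w 0) : AddMonoidAlgebra (PowerSeries ℂ) (ZMod p)) ^ (n - z.1) *
        stdMonomial (fun a => AddMonoidAlgebra.single a (w a)) z.1 z.2 := by
  choose u hu hs using exists_stdMonomial_single hp5 hw0 hw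
  set ex : Fin (n + 1) → ZMod p → ℕ := fun k c =>
    n - k + (if (k : ℕ) = 0 ∧ c = 0 then 1 else 0) with hex
  have hb : ∀ z : Fin (n + 1) × ZMod p,
      (AddMonoidAlgebra.single 0 (w 0) : AddMonoidAlgebra (PowerSeries ℂ) (ZMod p)) ^ (n - z.1) *
        stdMonomial (fun a => AddMonoidAlgebra.single a (w a)) z.1 z.2 =
      AddMonoidAlgebra.single z.2 (PowerSeries.X ^ ex z.1 z.2 * u z.1 z.2) := by
    intro z
    rw [hs, AddMonoidAlgebra.single_pow, AddMonoidAlgebra.single_mul_single, hw0, smul_zero,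
      zero_add, hex, pow_add, mul_assoc]
  simp only [hb]
  rw [Fintype.linearIndependent_iff]
  rintro g hg ⟨k, c⟩
  have h1 := congrArg (fun f => AddMonoidAlgebra.coeff f c) hg
  simp only [AddMonoidAlgebra.coeff_sum, AddMonoidAlgebra.smul_single, Finsupp.coe_finsetSum,
    Finset.sum_apply, AddMonoidAlgebra.coeff_single, Fintype.sum_prod_type,
    AddMonoidAlgebra.coeff_zero, Finsupp.coe_zero, Pi.zero_apply, Finsupp.single_apply,
    Finset.sum_ite_eq', Finset.mem_univ, if_true] at h1
  refine Fintype.linearIndependent_iff.1 (PowerSeries.linearIndependent_of_X_pow_mul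
    (h := fun k : Fin (n + 1) => PowerSeries.X ^ ex k c * u k c) (u := fun k => u k c)
    (d := fun k => ex k c) ?_ (fun k => hu k c) fun k => rfl) (fun k => g (k, c)) h1 k
  -- The orders are `n - k`, except `n + 1` instead of `n` for `k = 0`, `c = 0`. For `c = 0` the
  -- omitted order is the gap of an elliptic curve: no function has a single simple pole.
  intro i j hij
  have hi := i.2
  have hj := j.2
  ext
  simp only [hex] at hij
  split_ifs at hij <;> omega

end LowerBound

/-! ### The coordinate ring and its Hilbert function. -/

/-- The class of the variable `r_a` in the quotient. -/
noncomputable def coordClass {p : ℕ} (s t : ZMod p → ℂ) (a : ZMod p) :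
    MvPolynomial (ZMod p) ℂ ⧸ quadricIdeal s t :=
  Ideal.Quotient.mkₐ ℂ (quadricIdeal s t) (X a)

theorem gradedPiece_eq_pow {p : ℕ} (s t : ZMod p → ℂ) (n : ℕ) :
    gradedPiece s t n = Submodule.span ℂ (Set.range (coordClass s t)) ^ n := by
  have h : Set.range (coordClass s t) =
      (Ideal.Quotient.mkₐ ℂ (quadricIdeal s t)).toLinearMap '' Set.range X := by
    rw [← Set.range_comp]; rfl
  unfold gradedPiece
  rw [← homogeneousSubmodule_one_pow, Submodule.map_pow, homogeneousSubmodule_one_eq_span_X,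
    Submodule.map_span, h]

theorem isSumDetermined_coordClass {p : ℕ} (s t : ZMod p → ℂ) :
    IsSumDetermined (coordClass s t) := by
  intro a b c d ha hb hc hd habcd
  have hmem : ∀ f ∈ quadricSet s t, Ideal.Quotient.mkₐ ℂ (quadricIdeal s t) f = 0 := fun f hf =>
    Ideal.Quotient.eq_zero_iff_mem.2 (Ideal.subset_span hf)
  have hsmul : ∀ (z : ℂ) (e : ZMod p), coordClass s t a * coordClass s t b -
      coordClass s t c * coordClass s t d = z • (coordClass s t 0 * coordClass s t e) →
      coordClass s t a * coordClass s t b - coordClass s t c * coordClass s t d ∈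
        zeroMultiples (coordClass s t) 1 := fun z e h => by
    rw [h]
    refine Submodule.smul_mem _ _ ⟨coordClass s t e, ?_, rfl⟩
    rw [pow_one]
    exact Submodule.subset_span ⟨e, rfl⟩
  by_cases hab : a + b = 0
  · have hb' : b = -a := by linear_combination hab
    have hd' : d = -c := by linear_combination hab - habcd
    have h1 := hmem _ (Or.inr ⟨a, c, ha, hc, rfl⟩)
    subst hb' hd'
    refine hsmul (-s a ^ 2 + 2 * t a + s c ^ 2 - 2 * t c) 0 ?_
    rw [quadricTwo, ← smul_eq_C_mul] at h1
    simp only [map_sub, map_mul, map_smul, map_pow] at h1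
    rw [← pow_two]
    exact sub_eq_zero.1 h1
  · have h1 := hmem _ (Or.inl ⟨a, b, c, d, ha, hb, hc, hd, habcd, hab, rfl⟩)
    refine hsmul (s a + s b - s c - s d) (a + b) ?_
    rw [quadricOne, ← smul_eq_C_mul] at h1
    simp only [map_sub, map_mul, map_smul] at h1
    exact sub_eq_zero.1 h1

/-- The coordinate ring maps to the group algebra of `ZMod p` over the power series, `r_a` going to
a multiple of the group element `a`. -/
theorem exists_algHom {p : ℕ} [Fact p.Prime] (hp5 : 5 ≤ p) {s t : ZMod p → ℂ}
    (hst : IsQuadraticSolution p s t) :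
    ∃ (w : ZMod p → PowerSeries ℂ) (φ : (MvPolynomial (ZMod p) ℂ ⧸ quadricIdeal s t) →ₐ[ℂ]
      AddMonoidAlgebra (PowerSeries ℂ) (ZMod p)), w 0 = PowerSeries.X ∧
      (∀ a, a ≠ 0 → PowerSeries.constantCoeff (w a) = 1) ∧
      ∀ a, φ (coordClass s t a) = AddMonoidAlgebra.single a (w a) := by
  obtain ⟨w, hw, h1, h2⟩ := (hst.isSlopeSystem hp5).exists_series hp5
  -- The series found for index `0` has no meaning; `r_0` goes to `X`.
  set w' : ZMod p → PowerSeries ℂ := Function.update w 0 PowerSeries.X with hw'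
  have hw0 : w' 0 = PowerSeries.X := by simp [hw']
  have hwa : ∀ a, a ≠ 0 → w' a = w a := fun a ha => by simp [hw', ha]
  have hker : ∀ f ∈ quadricIdeal s t,
      aeval (R := ℂ) (fun a => (AddMonoidAlgebra.single a (w' a) :
        AddMonoidAlgebra (PowerSeries ℂ) (ZMod p))) f = 0 := by
    intro f hf
    rw [← RingHom.mem_ker]
    refine (Ideal.span_le (I := RingHom.ker _)).2 ?_ hf
    rintro _ (⟨a, b, c, d, ha, hb, hc, hd, habcd, hab, rfl⟩ | ⟨a, b, ha, hb, rfl⟩)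
    · simp only [SetLike.mem_coe, RingHom.mem_ker]
      have h3 := h1 a b c d ha hb hc hd habcd hab
      rw [quadricOne, ← smul_eq_C_mul]
      simp only [map_sub, map_mul, map_smul, aeval_X, AddMonoidAlgebra.single_mul_single,
        hwa a ha, hwa b hb, hwa c hc, hwa d hd, hwa _ hab, hw0, AddMonoidAlgebra.smul_single,
        zero_add, ← habcd, ← AddMonoidAlgebra.single_sub]
      rw [h3, PowerSeries.smul_eq_C_mul, map_sub, map_sub, map_add, sub_self,
        AddMonoidAlgebra.single_zero]
    · simp only [SetLike.mem_coe, RingHom.mem_ker]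
      have h3 := h2 a ha
      have h4 := h2 b hb
      rw [quadricTwo, ← smul_eq_C_mul]
      simp only [map_sub, map_mul, map_smul, map_pow, aeval_X,
        AddMonoidAlgebra.single_mul_single, AddMonoidAlgebra.single_pow, smul_zero,
        hwa a ha, hwa b hb, hwa _ (neg_ne_zero.2 ha), hwa _ (neg_ne_zero.2 hb), hw0,
        AddMonoidAlgebra.smul_single, add_neg_cancel, ← AddMonoidAlgebra.single_sub]
      rw [h3, h4, PowerSeries.smul_eq_C_mul, ← AddMonoidAlgebra.single_zero 0]
      congr 1
      simp only [map_sub, map_add, map_neg]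
      ring
  refine ⟨w', Ideal.Quotient.liftₐ _ (aeval _) hker, hw0, fun a ha => by rw [hwa a ha, hw], ?_⟩
  intro a
  exact (Ideal.Quotient.liftₐ_apply _ _ _ _).trans (aeval_X _ a)

theorem mainTheorem4 (p : ℕ) (hp : p.Prime) (hp5 : 5 ≤ p) (s t : ZMod p → ℂ)
    (hst : IsQuadraticSolution p s t) :
    Module.finrank ℂ (gradedPiece s t 0) = 1 ∧
      ∀ n : ℕ, 0 < n → Module.finrank ℂ (gradedPiece s t n) = n * p := by
  have : Fact p.Prime := ⟨hp⟩
  obtain ⟨w, φ, hw0, hw, hφ⟩ := exists_algHom hp5 hst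
  constructor
  · rw [gradedPiece_eq_pow, Submodule.pow_zero, Submodule.one_eq_span]
    refine finrank_span_singleton fun h => ?_
    have := congrArg φ h
    rw [map_one, map_zero] at this
    exact one_ne_zero this
  · intro n hn
    obtain ⟨n, rfl⟩ := Nat.exists_eq_succ_of_ne_zero hn.ne'
    rw [gradedPiece_eq_pow, Nat.succ_eq_add_one,
      (isSumDetermined_coordClass s t).pow_eq_span hp5 n, finrank_span_eq_card]
    · simp [ZMod.card]
    -- Independence of the images in the group algebra suffices.
    · refine LinearIndependent.of_comp φ.toLinearMap ?_
      convert linearIndependent_stdMonomial hp5 hw0 hw n using 1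
      · funext z
        simp only [Function.comp_apply, AlgHom.toLinearMap_apply, map_mul, map_pow,
          map_stdMonomial, hφ]
      · rfl
      · rfl
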